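/- Let $U$ (identifiers), $L$ (literals) and $V$ (query variables) be pairwise disjoint countably infinite sets, totally ordered, where every identifier has only finitely many predecessors; fix an injective binary encoding of $U\cup L\cup V$. A data triple is an element of $U\times U\times(U\cup L)$. A Web of Linked Data is a triple $W=(D,\mathrm{data},\mathrm{adoc})$ with a finite or countably infinite set $D$ of documents, a map $\mathrm{data}$ from $D$ to finite sets of data triples, and a partial surjective map $\mathrm{adoc}:U\to D$. A basic query pattern (BQP) is a finite set $P\subset (V\cup U)\times(V\cup U)\times(V\cup U\cup L)$; $\mathrm{vars}(P)$ is the set of its variables. A reachability criterion is a Turing computable function $c$ that maps every (data triple, identifier, BQP) to true or false; $c_{\mathsf{None}}$ is constantly false; $c$ is less restrictive than $c'$ if $c$ is true wherever $c'$ is and true at some argument where $c'$ is false. A CLD query consists of a BQP $P$, a finite set $S\subset U$ of seeds and a reachability criterion $c$. A document $d$ of $W$ is reachable if $d=\mathrm{adoc}(u)$ for some $u\in S$, or if $d=\mathrm{adoc}(u)$ for an identifier $u$ that occurs in a triple $t\in\mathrm{data}(d')$ of a reachable document $d'$ with $c(t,u,P)=\mathrm{true}$. The query result $Q(W)$ is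 the set of all valuations $\mu$ (maps from finite subsets of $V$ to $U\cup L$) with domain $\mathrm{vars}(P)$ such that every triple of $\mu[P]$ lies in $\mathrm{data}(d)$ for some reachable document $d$. Documents are encoded by the ordered list of their data triples, and $W$ by the (finite or infinite) word $\sharp\,\mathrm{enc}(u_1)\,\mathrm{enc}(\mathrm{adoc}(u_1))\,\sharp\cdots\sharp\,\mathrm{enc}(u_i)\,\mathrm{enc}(\mathrm{adoc}(u_i))\,\sharp\cdots$, where $u_1,u_2,\dots$ are the identifiers in $\mathrm{dom}(\mathrm{adoc})$ in their order. A finite set of valuations is encoded by concatenating the encodings of its elements in any order, each once; no finite word encodes an infinite set. An LD machine is a Turing machine with finitely many states and tape symbols and five tapes: a read-only ordinary input tape, a Web tape holding $\mathrm{enc}(W)$, a two-way infinite work tape, a right-infinite link traversal tape, and an append-only output tape. The Web tape is accessible only in a special state "expand". There, let $b$ be the longest suffix of the word on the link traversal tape that consists of bits: if $b=\mathrm{enc}(u)$ for an identifier $u$ such that the Web tape contains $\sharp\,\mathrm{enc}(u)\,\mathrm{enc}(\mathrm{adoc}(u))\,\sharp$, then $\mathrm{enc}(\mathrm{adoc}(u))\,\sharp$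 is appended to that word; otherwise $\sharp$ is appended. A decision problem with inputs $(W,X)$ is LD machine decidable if some LD machine, started with $\mathrm{enc}(W)$ on the Web tape and $\mathrm{enc}(X)$ on the ordinary input tape, halts in an accepting state for every yes-instance and in a rejecting state for every no-instance. The problem ComputabilityCLD is: given a (potentially infinite) Web of Linked Data $W$ and a CLD query $Q$ with a nonempty set $S$ of seeds and a criterion $c$ less restrictive than $c_{\mathsf{None}}$, does an LD machine exist that, with $\mathrm{enc}(W)$ on its Web tape (and no further input), halts after finitely many steps with a possible encoding of $Q(W)$ on its output tape? Theorem. For every injective encoding of such CLD queries as finite words, ComputabilityCLD is not LD machine decidable. -/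

import Mathlib

namespace LinkedData

/-! ### Terms, data triples and Webs of Linked Data

`U` is the set of identifiers, `L` the set of literals, `V` the set of query variables. -/

/-- The disjoint union of the variables, the identifiers and the literals. -/
inductive Term (U L V : Type*) where
  | var (v : V)
  | id (u : U)
  | lit (c : L)

/-- A data triple: an element of `U × U × (U ∪ L)`. -/
@[ext]
structure DataTriple (U L : Type*) where
  subj : U
  pred : U
  obj : U ⊕ L

namespace DataTriple

variable {U L : Type*}

/-- The set of all identifiers in a data triple. -/
def ids (t : DataTriple U L) : Set U :=
  {u | u = t.subj ∨ u = t.pred ∨ Sum.inl u = t.obj}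

/-- The total order on data triples: lexicographic, with identifiers before literals. -/
noncomputable instance [LinearOrder U] [LinearOrder L] : LinearOrder (DataTriple U L) :=
  LinearOrder.lift' (β := U ×ₗ U ×ₗ (U ⊕ₗ L))
    (fun t => toLex (t.subj, toLex (t.pred, toLex t.obj))) (by
      rintro ⟨s, p, o⟩ ⟨s', p', o'⟩ h
      simpa using h)

/-- The components of a data triple as terms. -/
def terms {V : Type*} (t : DataTriple U L) : Term U L V × Term U L V × Term U L V :=
  (Term.id t.subj, Term.id t.pred, t.obj.elim Term.id Term.lit)

end DataTriple

/-- A Web of Linked Data. -/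
structure Web (U L : Type*) where
  /-- the LD documents -/
  Doc : Type
  countable_doc : Countable Doc
  /-- the (finite) data of a document -/
  data : Doc → Finset (DataTriple U L)
  /-- the partial mapping from identifiers to authoritative documents -/
  adoc : U → Option Doc
  adoc_surjective : ∀ d, ∃ u, adoc u = some d

namespace Web

variable {U L : Type*}

/-- All data triples in a Web. -/
def allData (W : Web U L) : Set (DataTriple U L) :=
  {t | ∃ d, t ∈ W.data d}

open Classical in
/-- The induced subweb given by a set of documents. -/
noncomputable def induced (W : Web U L) (D : Set W.Doc) : Web U L where
  Doc := {d : W.Doc // d ∈ D}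
  countable_doc := by
    have := W.countable_doc
    infer_instance
  data d := W.data d.1
  adoc u := (W.adoc u).bind fun d => if h : d ∈ D then some ⟨d, h⟩ else none
  adoc_surjective := by
    rintro ⟨d, hd⟩
    obtain ⟨u, hu⟩ := W.adoc_surjective d
    exact ⟨u, by simp [hu, hd]⟩

end Web

/-! ### Basic query patterns and valuations -/

/-- A triple pattern: an element of `(V ∪ U) × (V ∪ U) × (V ∪ U ∪ L)`. -/
structure TriplePattern (U L V : Type*) where
  subj : V ⊕ U
  pred : V ⊕ U
  obj : Term U L V

namespace TriplePattern

variable {U L V : Type*}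

/-- The components of a triple pattern as terms. -/
def terms (tp : TriplePattern U L V) : Term U L V × Term U L V × Term U L V :=
  (tp.subj.elim Term.var Term.id, tp.pred.elim Term.var Term.id, tp.obj)

/-- The set of all variables in a triple pattern. -/
def vars (tp : TriplePattern U L V) : Set V :=
  {v | Term.var v = tp.terms.1 ∨ Term.var v = tp.terms.2.1 ∨ Term.var v = tp.terms.2.2}

end TriplePattern

/-- A basic query pattern: a finite set of triple patterns. -/
abbrev BQP (U L V : Type*) := Finset (TriplePattern U L V)

/-- The set of all variables in a basic query pattern. -/
def BQP.vars {U L V : Type*} (P : BQP U L V) : Set V := {v | ∃ tp ∈ P, v ∈ tp.vars}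

/-- A valuation: a mapping from a finite set of variables to `U ∪ L`. -/
structure Valuation (U L V : Type*) where
  val : V → Option (U ⊕ L)
  finite_dom : {v | (val v).isSome}.Finite

namespace Valuation

variable {U L V : Type*}

/-- The domain of a valuation. -/
noncomputable def dom (μ : Valuation U L V) : Finset V := μ.finite_dom.toFinset

/-- Replace a term by its value if it is a variable in the domain. -/
def substTerm (μ : Valuation U L V) : Term U L V → Term U L V
  | .var v => (μ.val v).elim (.var v) (Sum.elim .id .lit)
  | x => x

/-- `μ[tp]`. -/
def substPattern (μ : Valuation U L V) (tp : TriplePattern U L V) :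
    Term U L V × Term U L V × Term U L V :=
  (μ.substTerm tp.terms.1, μ.substTerm tp.terms.2.1, μ.substTerm tp.terms.2.2)

/-- `μ[P]`. -/
def substBQP (μ : Valuation U L V) (P : BQP U L V) :
    Set (Term U L V × Term U L V × Term U L V) :=
  {x | ∃ tp ∈ P, x = μ.substPattern tp}

end Valuation

/-! ### Encodings -/

/-- The symbols used in encodings: bits, the separator `♯`, and punctuation. -/
inductive Symbol where
  | bit (b : Bool)
  | sharp
  | langle
  | rangle
  | llangle
  | rrangle
  | comma
  | arrow

/-- A numbering of the symbols. -/
def Symbol.code : Symbol → ℕ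
  | bit false => 0
  | bit true => 1
  | sharp => 2
  | langle => 3
  | rangle => 4
  | llangle => 5
  | rrangle => 6
  | comma => 7
  | arrow => 8

/-- A binary representation of the identifiers, literals and variables. -/
structure TermEncoding (U L V : Type*) where
  bits : Term U L V → List Bool
  injective : Function.Injective bits

/-- The list `w₁ , w₂ , … , wₙ`, separated by commas. -/
def commaSep (ws : List (List Symbol)) : List Symbol :=
  List.intercalate [Symbol.comma] ws

namespace TermEncoding

variable {U L V : Type*} (E : TermEncoding U L V)

/-- The binary representation of a term, as a word over the encoding alphabet. -/
def encTerm (x : Term U L V) : List Symbol := (E.bits x).map Symbol.bit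

/-- The word `⟨ enc(s) , enc(p) , enc(o) ⟩`. -/
def encTerms (x : Term U L V × Term U L V × Term U L V) : List Symbol :=
  [Symbol.langle] ++ commaSep [E.encTerm x.1, E.encTerm x.2.1, E.encTerm x.2.2]
    ++ [Symbol.rangle]

/-- The encoding of a data triple. -/
def encTriple (t : DataTriple U L) : List Symbol := E.encTerms t.terms

/-- The encoding of a finite set of data triples, listed in the order of the triples. -/
noncomputable def encTriples [LinearOrder U] [LinearOrder L] (T : Finset (DataTriple U L)) :
    List Symbol :=
  [Symbol.llangle] ++ commaSep ((T.sort (· ≤ ·)).map E.encTriple) ++ [Symbol.rrangle]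

/-- The encoding of a document of a Web. -/
noncomputable def encDoc [LinearOrder U] [LinearOrder L] (W : Web U L) (d : W.Doc) :
    List Symbol :=
  E.encTriples (W.data d)

/-- The encoding of a valuation, listed in the order of the variables. -/
noncomputable def encValuation [LinearOrder V] (μ : Valuation U L V) : List Symbol :=
  [Symbol.llangle] ++
    commaSep ((μ.dom.sort (· ≤ ·)).map fun v =>
      E.encTerm (Term.var v) ++ [Symbol.arrow] ++ E.encTerm (μ.substTerm (Term.var v))) ++
    [Symbol.rrangle]

/-- `w` is a possible encoding of the set `Ω` of valuations: the encodings of the elements of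
`Ω` in some order, each once. In particular no finite word encodes an infinite set. -/
def IsEncoding [LinearOrder V] (Ω : Set (Valuation U L V)) (w : List Symbol) : Prop :=
  ∃ l : List (Valuation U L V), l.Nodup ∧ (∀ μ, μ ∈ l ↔ μ ∈ Ω) ∧ w = l.flatMap E.encValuation

/-- The part `♯ enc(u₁) enc(adoc(u₁)) ♯ … ♯ enc(uᵢ) enc(adoc(uᵢ)) ♯` of the encoding of a Web,
where `u₁, …, uᵢ` are the identifiers up to `u` in the domain of `adoc`, in their order. -/
noncomputable def encWebUpTo [LinearOrder U] [LocallyFiniteOrderBot U] [LinearOrder L]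
    (W : Web U L) (u : U) : List Symbol :=
  [Symbol.sharp] ++ ((Finset.Iic u).sort (· ≤ ·)).flatMap fun v =>
    match W.adoc v with
    | none => []
    | some d => E.encTerm (Term.id v) ++ E.encDoc W d ++ [Symbol.sharp]

open Classical in
/-- The content of the cells of a right-infinite tape that holds the (potentially infinite)
encoding of a Web; `none` is the blank. The words `encWebUpTo W u` are prefixes of one another
and of the encoding, so each cell is given by any of them that is long enough. -/
noncomputable def webTape [LinearOrder U] [LocallyFiniteOrderBot U] [LinearOrder L]
    (W : Web U L) (i : ℕ) : Option Symbol :=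
  if h : ∃ u, i < (E.encWebUpTo W u).length then (E.encWebUpTo W h.choose)[i]? else none

end TermEncoding

/-- The word on a tape contains `w`. -/
def TapeContains (tape : ℕ → Option Symbol) (w : List Symbol) : Prop :=
  ∃ k, ∀ i < w.length, tape (k + i) = w[i]?

/-! ### Reachability and conjunctive Linked Data queries -/

/-- `c` is Turing computable on encodings of its arguments; the basic query pattern is given by
an arbitrary listing of its triple patterns. -/
def IsComputableCriterion {U L V : Type*} (E : TermEncoding U L V)
    (c : DataTriple U L → U → BQP U L V → Bool) : Prop :=
  ∃ f : List ℕ →. Bool, Partrec f ∧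
    ∀ (t : DataTriple U L) (u : U) (P : BQP U L V) (l : List (TriplePattern U L V)),
      (l : Multiset (TriplePattern U L V)) = P.val →
      f ((E.encTriple t ++ E.encTerm (Term.id u) ++ [Symbol.llangle] ++
          commaSep (l.map fun tp => E.encTerms tp.terms) ++ [Symbol.rrangle]).map Symbol.code) =
        Part.some (c t u P)

/-- A reachability criterion: a Turing computable function that decides for a data triple, an
identifier and a basic query pattern whether the data link has to be followed. -/
structure ReachabilityCriterion {U L V : Type*} (E : TermEncoding U L V) where
  holds : DataTriple U L → U → BQP U L V → Bool
  computable : IsComputableCriterion E holds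

namespace ReachabilityCriterion

variable {U L V : Type*} {E : TermEncoding U L V}

/-- The criterion `c_None`, which always returns false. -/
def cNone (E : TermEncoding U L V) : ReachabilityCriterion E where
  holds _ _ _ := false
  computable := ⟨fun _ => Part.some false, Computable.const false, fun _ _ _ _ _ => rfl⟩

/-- `c` is less restrictive than `c'`. -/
def LessRestrictive (c c' : ReachabilityCriterion E) : Prop :=
  (∀ t u P, c'.holds t u P = true → c.holds t u P = true) ∧
    ∃ t u P, c.holds t u P = true ∧ c'.holds t u P = false

end ReachabilityCriterion

/-- A document is `(c, P)`-reachable from the seeds `S` in `W`. -/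
inductive Web.Reachable {U L V : Type*} {E : TermEncoding U L V} (W : Web U L)
    (S : Finset U) (c : ReachabilityCriterion E) (P : BQP U L V) : W.Doc → Prop
  | seed (u : U) (d : W.Doc) (hu : u ∈ S) (hd : W.adoc u = some d) : W.Reachable S c P d
  | link (d' : W.Doc) (t : DataTriple U L) (u : U) (d : W.Doc)
      (hd' : W.Reachable S c P d') (ht : t ∈ W.data d') (hu : u ∈ t.ids)
      (hc : c.holds t u P = true) (hd : W.adoc u = some d) : W.Reachable S c P d

/-- The `(S, c, P)`-reachable part of a Web. -/
noncomputable def Web.reachablePart {U L V : Type*} {E : TermEncoding U L V} (W : Web U L)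
    (S : Finset U) (c : ReachabilityCriterion E) (P : BQP U L V) : Web U L :=
  W.induced {d | W.Reachable S c P d}

/-- A conjunctive Linked Data (CLD) query. -/
structure CLDQuery {U L V : Type*} (E : TermEncoding U L V) where
  pattern : BQP U L V
  seeds : Finset U
  crit : ReachabilityCriterion E

/-- The result of a CLD query over a Web: all valuations `μ` with `dom(μ) = vars(P)` that map `P`
to a subset of the data in the reachable part of the Web. -/
def CLDQuery.result {U L V : Type*} {E : TermEncoding U L V} (q : CLDQuery E) (W : Web U L) :
    Set (Valuation U L V) :=
  {μ | (μ.dom : Set V) = q.pattern.vars ∧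
    μ.substBQP q.pattern ⊆
      DataTriple.terms '' (W.reachablePart q.seeds q.crit q.pattern).allData}

/-! ### LD machines -/

/-- Head movements. -/
inductive Move where
  | left
  | stay
  | right

/-- Head movement on a two-way infinite tape. -/
def Move.onInt : Move → ℤ → ℤ
  | left, i => i - 1
  | stay, i => i
  | right, i => i + 1

/-- Head movement on a right-infinite tape; a head on the first cell cannot move left. -/
def Move.onNat : Move → ℕ → ℕ
  | left, i => i - 1
  | stay, i => i
  | right, i => i + 1

/-- What a machine with states `Q` and tape symbols `A` does in one ordinary step. A written
`none` is the blank; on the append-only output tape at most one symbol is appended. -/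
structure Action (Q A : Type) where
  next : Q
  moveInput : Move
  writeWork : Option A
  moveWork : Move
  writeLink : Option A
  moveLink : Move
  output : Option A

/-- An LD machine. Its tape symbols are the encoding symbols and finitely many auxiliary ones.
The transition function gets the state and the symbols under the heads of the ordinary input
tape, the work tape and the link traversal tape; the machine halts where it is undefined. -/
structure LDMachine where
  State : Type
  finite_state : Finite State
  Aux : Type
  finite_aux : Finite Aux
  start : State
  expand : State
  accepting : Set State
  rejecting : Set State
  disjoint : Disjoint accepting rejecting
  trans : State → Option (Symbol ⊕ Aux) → Option (Symbol ⊕ Aux) → Option (Symbol ⊕ Aux) →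
    Option (Action State (Symbol ⊕ Aux))

namespace LDMachine

/-- The tape symbols of a machine. -/
abbrev TapeSymbol (M : LDMachine) : Type := Symbol ⊕ M.Aux

/-- A configuration (without the contents of the two read-only input tapes). -/
structure Config (M : LDMachine) where
  state : M.State
  inputHead : ℤ
  work : ℤ → Option M.TapeSymbol
  workHead : ℤ
  link : ℕ → Option M.TapeSymbol
  linkHead : ℕ
  output : List M.TapeSymbol

/-- The initial configuration: the work tapes and the output tape are empty. -/
def init (M : LDMachine) : M.Config where
  state := M.start
  inputHead := 0
  work _ := none
  workHead := 0
  link _ := none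
  linkHead := 0
  output := []

/-- The ordinary input tape with the word `x` on the cells `0, …, |x| - 1`. -/
def inputTape (M : LDMachine) (x : List Symbol) (i : ℤ) : Option M.TapeSymbol :=
  if 0 ≤ i then (x[i.toNat]?).map Sum.inl else none

/-- The length of the word on a right-infinite tape, that is, the first cell from which on all
cells are blank (only finitely many cells of a work tape are ever not blank). -/
noncomputable def wordLength {A : Type} (tape : ℕ → Option A) : ℕ :=
  sInf {n | ∀ m ≥ n, tape m = none}

/-- Append a word to the right end of the word on a tape. -/
noncomputable def appendWord {A : Type} (tape : ℕ → Option A) (w : List A) (i : ℕ) : Option A :=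
  if i < wordLength tape then tape i else w[i - wordLength tape]?

/-- The maximal suffix of bits of the word on a tape is `b`. -/
def EndsWithBits {A : Type} (tape : ℕ → Option (Symbol ⊕ A)) (b : List Bool) : Prop :=
  ∃ k, wordLength tape = k + b.length ∧
    (∀ i < b.length, tape (k + i) = (b[i]?).map fun x => Sum.inl (Symbol.bit x)) ∧
    ∀ j, k = j + 1 → ∀ x, tape j ≠ some (Sum.inl (Symbol.bit x))

section

variable {U L V : Type*} [LinearOrder U] [LocallyFiniteOrderBot U] [LinearOrder L]
  (E : TermEncoding U L V) (M : LDMachine) (W : Web U L)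

/-- The expand procedure may copy the encoding of `d` as the document of an identifier `u`:
the word on the link traversal tape ends with `enc(u)`, and the word on the Web tape contains
`♯ enc(u) enc(adoc(u)) ♯`, where `adoc(u) = d`. -/
def Expands (link : ℕ → Option M.TapeSymbol) (d : W.Doc) : Prop :=
  ∃ u, EndsWithBits link (E.bits (Term.id u)) ∧ W.adoc u = some d ∧
    TapeContains (E.webTape W)
      ([Symbol.sharp] ++ E.encTerm (Term.id u) ++ E.encDoc W d ++ [Symbol.sharp])

open Classical in
/-- The link traversal tape after the expand procedure. -/
noncomputable def expandLink (link : ℕ → Option M.TapeSymbol) : ℕ → Option M.TapeSymbol :=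
  if h : ∃ d, M.Expands E W link d then
    appendWord link ((E.encDoc W h.choose ++ [Symbol.sharp]).map Sum.inl)
  else
    appendWord link [Sum.inl Symbol.sharp]

open Classical in
/-- One step of the machine with `W` on the Web tape and `x` on the ordinary input tape; `none`
if the machine halts. In the expand state the expand procedure is performed first. -/
noncomputable def step (x : List Symbol) (c : M.Config) : Option M.Config :=
  let link := if c.state = M.expand then M.expandLink E W c.link else c.link
  (M.trans c.state (M.inputTape x c.inputHead) (c.work c.workHead) (link c.linkHead)).map fun a =>
    { state := a.next
      inputHead := a.moveInput.onInt c.inputHead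
      work := Function.update c.work c.workHead a.writeWork
      workHead := a.moveWork.onInt c.workHead
      link := Function.update link c.linkHead a.writeLink
      linkHead := a.moveLink.onNat c.linkHead
      output := c.output ++ a.output.toList }

/-- The machine with `W` on the Web tape and `x` on the ordinary input tape halts after finitely
many steps in configuration `c`. -/
def HaltsAt (x : List Symbol) (c : M.Config) : Prop :=
  Relation.ReflTransGen (fun c₁ c₂ => M.step E W x c₁ = some c₂) M.init c ∧
    M.step E W x c = none

/-- The machine, with `W` on the Web tape and no further input, halts after finitely many steps
with a possible encoding of `Ω` on its output tape. -/
def HaltsComputing [LinearOrder V] (Ω : Set (Valuation U L V)) : Prop :=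
  ∃ c, M.HaltsAt E W [] c ∧ ∃ w, E.IsEncoding Ω w ∧ c.output = w.map Sum.inl

end

end LDMachine

/-- The decision problem for `DP ⊆ 𝒲 × X` is LD machine decidable, where `enc` is the encoding
of the elements of `X` on the ordinary input tape. -/
def LDMachineDecidable {U L V : Type*} [LinearOrder U] [LocallyFiniteOrderBot U] [LinearOrder L]
    (E : TermEncoding U L V) {X : Type*} (enc : X → List Symbol) (𝒲 : Set (Web U L))
    (DP : Web U L → X → Prop) : Prop :=
  ∃ M : LDMachine, ∀ W ∈ 𝒲, ∀ x : X,
    (DP W x → ∃ c, M.HaltsAt E W (enc x) c ∧ c.state ∈ M.accepting) ∧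
    (¬ DP W x → ∃ c, M.HaltsAt E W (enc x) c ∧ c.state ∈ M.rejecting)

/-- The CLD queries with a nonempty set of seeds and a reachability criterion that is less
restrictive than `c_None`. -/
def ProperCLDQuery {U L V : Type*} (E : TermEncoding U L V) : Type _ :=
  {q : CLDQuery E // q.seeds.Nonempty ∧
    q.crit.LessRestrictive (ReachabilityCriterion.cNone E)}

/-- The problem ComputabilityCLD: does an LD machine exist that computes the result of the query
`q` over `W` and halts? -/
def ComputabilityCLD {U L V : Type*} [LinearOrder U] [LocallyFiniteOrderBot U] [LinearOrder L]
    [LinearOrder V] (E : TermEncoding U L V) (W : Web U L) (q : ProperCLDQuery E) : Prop :=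
  ∃ M : LDMachine, M.HaltsComputing E W (q.1.result W)

end LinkedData

namespace LinkedData

/-! ### The encoding of a Web -/

/-! The machine sought by ComputabilityCLD may depend on the Web. Since the output has no input to
depend on, a finite result can be hard-coded, while an infinite result has no encoding at all; so
the problem asks whether the query result is finite (`exists_haltsComputing_iff`).

Finiteness is not decidable by finitely many lookups. A halting run consults the documents of
finitely many identifiers only (`HaltsAt.exists_finset`). On the infinite chain, where document `i`
links to document `i + 1`, the query for all links has infinitely many answers, so a decider has to
reject. Empty the document of an identifier that this run never consulted: the run is unchanged and
still rejects, but the chain is now cut, the result is finite, and the decider has to accept. As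
runs are deterministic (`HaltsAt.eq`), this is a contradiction.

The technical core is that the expand procedure, although defined through the whole Web tape,
depends only on the data of the one identifier at the end of the link traversal tape
(`expandLink_of_endsWithBits`). -/

theorem sort_union_of_lt {α : Type*} [LinearOrder α] {s t : Finset α}
    (h : ∀ a ∈ s, ∀ b ∈ t, a < b) :
    (s ∪ t).sort (· ≤ ·) = s.sort (· ≤ ·) ++ t.sort (· ≤ ·) := by
  have hd : Disjoint s t :=
    Finset.disjoint_left.2 fun a hs ht => (h a hs a ht).false
  refine List.Perm.eq_of_pairwise' (r := (· ≤ ·)) (Finset.pairwise_sort _ _) ?_ ?_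
  · rw [List.pairwise_append]
    refine ⟨Finset.pairwise_sort _ _, Finset.pairwise_sort _ _, fun a ha b hb => ?_⟩
    exact (h a (by simpa using ha) b (by simpa using hb)).le
  · rw [← Multiset.coe_eq_coe, ← Multiset.coe_add]
    simp only [Finset.sort_eq]
    rw [← Finset.disjUnion_eq_union s t hd]
    rfl

/-- The data of the document of an identifier. -/
def Web.lookup {U L : Type*} (W : Web U L) (u : U) : Option (Finset (DataTriple U L)) :=
  (W.adoc u).map W.data

namespace TermEncoding

variable {U L V : Type*} [LinearOrder U] [LinearOrder L]
  (E : TermEncoding U L V) (W : Web U L)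

/-- The part of the encoding of a Web that belongs to the identifier `u`. -/
noncomputable def encEntry (u : U) : List Symbol :=
  match W.adoc u with
  | none => []
  | some d => E.encTerm (Term.id u) ++ E.encDoc W d ++ [Symbol.sharp]

theorem encEntry_of_none {u : U} (h : W.adoc u = none) : E.encEntry W u = [] := by
  simp [encEntry, h]

theorem encEntry_of_some {u : U} {d : W.Doc} (h : W.adoc u = some d) :
    E.encEntry W u = E.encTerm (Term.id u) ++ E.encDoc W d ++ [Symbol.sharp] := by
  simp [encEntry, h]

/-- Supplies the separator in front of an entry: it is the one that closes the previous nonempty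
entry, or the initial one. -/
theorem exists_sharp_flatMap_encEntry (l : List U) :
    ∃ w, [Symbol.sharp] ++ l.flatMap (E.encEntry W) = w ++ [Symbol.sharp] := by
  induction l using List.reverseRecOn with
  | nil => exact ⟨[], rfl⟩
  | append_singleton l v ih =>
    rw [List.flatMap_append, List.flatMap_singleton]
    rcases h : W.adoc v with _ | d
    · simpa [E.encEntry_of_none W h] using ih
    · exact ⟨[Symbol.sharp] ++ l.flatMap (E.encEntry W) ++ E.encTerm (Term.id v) ++ E.encDoc W d,
        by simp [E.encEntry_of_some W h]⟩

variable [LocallyFiniteOrderBot U]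

theorem encWebUpTo_eq (u : U) : E.encWebUpTo W u =
    [Symbol.sharp] ++ ((Finset.Iic u).sort (· ≤ ·)).flatMap (E.encEntry W) :=
  rfl

theorem encWebUpTo_prefix {u v : U} (h : u ≤ v) : E.encWebUpTo W u <+: E.encWebUpTo W v := by
  have hs : Finset.Iic v = Finset.Iic u ∪ (Finset.Iic v).filter (u < ·) := by
    ext a
    simp only [Finset.mem_Iic, Finset.mem_union, Finset.mem_filter]
    constructor
    · intro ha
      rcases le_or_gt a u with h' | h'
      · exact Or.inl h'
      · exact Or.inr ⟨ha, h'⟩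
    · rintro (ha | ha)
      · exact ha.trans h
      · exact ha.1
  rw [encWebUpTo_eq, encWebUpTo_eq, hs, sort_union_of_lt, List.flatMap_append,
    ← List.append_assoc]
  · exact List.prefix_append _ _
  · intro a ha b hb
    exact (Finset.mem_Iic.1 ha).trans_lt (Finset.mem_filter.1 hb).2

/-- By the prefix property, the identifier chosen in the definition of `webTape` is irrelevant. -/
theorem webTape_eq {u : U} {i : ℕ} (hi : i < (E.encWebUpTo W u).length) :
    E.webTape W i = (E.encWebUpTo W u)[i]? := by
  have h : ∃ u, i < (E.encWebUpTo W u).length := ⟨u, hi⟩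
  rw [webTape, dif_pos h]
  have key : ∀ {a b : U}, a ≤ b → i < (E.encWebUpTo W a).length →
      (E.encWebUpTo W b)[i]? = (E.encWebUpTo W a)[i]? := by
    intro a b hab ha
    obtain ⟨r, hr⟩ := E.encWebUpTo_prefix W hab
    rw [← hr, List.getElem?_append_left ha]
  rcases le_total u h.choose with h' | h'
  · exact key h' hi
  · exact (key h' h.choose_spec).symm

/-- The largest element of `Finset.Iic u` is `u`, so its entry comes last. -/
theorem encWebUpTo_eq_append {u : U} {d : W.Doc} (hd : W.adoc u = some d) :
    ∃ w, E.encWebUpTo W u =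
      w ++ ([Symbol.sharp] ++ E.encTerm (Term.id u) ++ E.encDoc W d ++ [Symbol.sharp]) := by
  have hs : Finset.Iic u = Finset.Iio u ∪ {u} := by
    ext a
    simp [le_iff_lt_or_eq]
  rw [encWebUpTo_eq, hs, sort_union_of_lt, List.flatMap_append, Finset.sort_singleton,
    List.flatMap_singleton, ← List.append_assoc]
  · obtain ⟨w, hw⟩ := E.exists_sharp_flatMap_encEntry W ((Finset.Iio u).sort (· ≤ ·))
    refine ⟨w, ?_⟩
    rw [hw, E.encEntry_of_some W hd]
    simp
  · intro a ha b hb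
    rw [Finset.mem_singleton.1 hb]
    exact Finset.mem_Iio.1 ha

/-- Makes the tape condition in `Expands` automatic, so that expansion is governed by `adoc` alone.
-/
theorem tapeContains_webTape {u : U} {d : W.Doc} (hd : W.adoc u = some d) :
    TapeContains (E.webTape W)
      ([Symbol.sharp] ++ E.encTerm (Term.id u) ++ E.encDoc W d ++ [Symbol.sharp]) := by
  obtain ⟨w, hw⟩ := E.encWebUpTo_eq_append W hd
  refine ⟨w.length, fun i hi => ?_⟩
  rw [E.webTape_eq W (u := u), hw, List.getElem?_append_right (by omega)]
  · congr 1
    omega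
  · rw [hw, List.length_append]
    omega

end TermEncoding

/-! ### Locality of the runs of an LD machine -/

namespace LDMachine

theorem EndsWithBits.eq {A : Type} {tape : ℕ → Option (Symbol ⊕ A)} {b b' : List Bool}
    (h : EndsWithBits tape b) (h' : EndsWithBits tape b') : b = b' := by
  have key : ∀ {b b' : List Bool} {k k' : ℕ}, wordLength tape = k + b.length →
      (∀ i < b.length, tape (k + i) = (b[i]?).map fun x => Sum.inl (Symbol.bit x)) →
      wordLength tape = k' + b'.length →
      (∀ j, k' = j + 1 → ∀ x, tape j ≠ some (Sum.inl (Symbol.bit x))) → k' ≤ k := by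
    intro b b' k k' h₁ h₂ h₃ h₄
    -- If `k < k'`, cell `k' - 1` lies inside the block of `b` and holds a bit, against the
    -- maximality of `b'`.
    by_contra! hlt
    have hi : k' - 1 - k < b.length := by omega
    have := h₂ _ hi
    rw [show k + (k' - 1 - k) = k' - 1 by omega, List.getElem?_eq_getElem hi] at this
    exact h₄ (k' - 1) (by omega) _ this
  obtain ⟨k, h₁, h₂, h₃⟩ := h
  obtain ⟨k', h₁', h₂', h₃'⟩ := h'
  obtain rfl : k = k' := le_antisymm (key h₁' h₂' h₁ h₃) (key h₁ h₂ h₁' h₃')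
  have hl : b.length = b'.length := by omega
  refine List.ext_getElem hl fun i hi hi' => ?_
  have := (h₂ i hi).symm.trans (h₂' i hi')
  simpa [List.getElem?_eq_getElem hi, List.getElem?_eq_getElem hi'] using this

variable {U L V : Type*} [LinearOrder U] [LocallyFiniteOrderBot U] [LinearOrder L]
  (E : TermEncoding U L V) (M : LDMachine) (W : Web U L)

/-- The maximal bit suffix is unique and the term encoding injective, so only `u` can be expanded.
The default `[]` is the failed lookup, where just the separator is appended. -/
theorem expandLink_of_endsWithBits {link : ℕ → Option M.TapeSymbol} {u : U}
    (hu : EndsWithBits link (E.bits (Term.id u))) :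
    M.expandLink E W link = appendWord link
      ((((W.lookup u).map E.encTriples).getD [] ++ [Symbol.sharp]).map Sum.inl) := by
  have huniq : ∀ d, M.Expands E W link d → W.adoc u = some d := by
    rintro d ⟨u', hu', hd, -⟩
    obtain rfl : u = u' := by
      have := E.injective (hu.eq hu')
      simpa using this
    exact hd
  unfold expandLink
  rcases h : W.adoc u with _ | d
  · rw [dif_neg]
    · simp [Web.lookup, h]
    · rintro ⟨d, hd⟩
      have := huniq d hd
      rw [h] at this
      exact absurd this (by simp)
  · have hex : ∃ d, M.Expands E W link d := ⟨d, u, hu, h, E.tapeContains_webTape W h⟩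
    rw [dif_pos hex]
    have hc := huniq _ hex.choose_spec
    simp [Web.lookup, hc, TermEncoding.encDoc]

theorem expandLink_of_forall_not_endsWithBits {link : ℕ → Option M.TapeSymbol}
    (hu : ∀ u, ¬ EndsWithBits link (E.bits (Term.id u))) :
    M.expandLink E W link = appendWord link [Sum.inl Symbol.sharp] := by
  rw [expandLink, dif_neg]
  rintro ⟨d, u, h, -⟩
  exact hu u h

/-- A step of a machine depends on the data of finitely many identifiers only. -/
theorem exists_finset_step_eq (x : List Symbol) (c : M.Config) :
    ∃ F : Finset U, ∀ W W' : Web U L, (∀ u ∈ F, W'.lookup u = W.lookup u) →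
      M.step E W' x c = M.step E W x c := by
  -- This case distinction concerns the configuration only, so `F` can be chosen before the Webs.
  by_cases h : ∃ u, EndsWithBits c.link (E.bits (Term.id u))
  · obtain ⟨u, hu⟩ := h
    refine ⟨{u}, fun W W' hW => ?_⟩
    have : M.expandLink E W' c.link = M.expandLink E W c.link := by
      rw [expandLink_of_endsWithBits E M W hu, expandLink_of_endsWithBits E M W' hu,
        hW u (Finset.mem_singleton_self u)]
    simp only [step, this]
  · push Not at h
    refine ⟨∅, fun W W' _ => ?_⟩
    have : M.expandLink E W' c.link = M.expandLink E W c.link := by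
      rw [expandLink_of_forall_not_endsWithBits E M W h,
        expandLink_of_forall_not_endsWithBits E M W' h]
    simp only [step, this]

/-- A halting run of a machine depends on the data of finitely many identifiers only. -/
theorem HaltsAt.exists_finset {E : TermEncoding U L V} {M : LDMachine} {W : Web U L}
    {x : List Symbol} {c : M.Config} (h : M.HaltsAt E W x c) :
    ∃ F : Finset U, ∀ W' : Web U L, (∀ u ∈ F, W'.lookup u = W.lookup u) →
      M.HaltsAt E W' x c := by
  classical
  have hrun : ∀ c, Relation.ReflTransGen (fun c₁ c₂ => M.step E W x c₁ = some c₂) M.init c →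
      ∃ F : Finset U, ∀ W' : Web U L, (∀ u ∈ F, W'.lookup u = W.lookup u) →
        Relation.ReflTransGen (fun c₁ c₂ => M.step E W' x c₁ = some c₂) M.init c := by
    intro c hc
    induction hc with
    | refl => exact ⟨∅, fun _ _ => .refl⟩
    | @tail b c _ hbc ih =>
      obtain ⟨F, hF⟩ := ih
      obtain ⟨G, hG⟩ := exists_finset_step_eq E M x b
      refine ⟨F ∪ G, fun W' hW' => (hF W' fun u hu => hW' u (by simp [hu])).tail ?_⟩
      rw [hG W W' fun u hu => hW' u (by simp [hu])]
      exact hbc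
  obtain ⟨F, hF⟩ := hrun c h.1
  obtain ⟨G, hG⟩ := exists_finset_step_eq E M x c
  refine ⟨F ∪ G, fun W' hW' => ⟨hF W' fun u hu => hW' u (by simp [hu]), ?_⟩⟩
  rw [hG W W' fun u hu => hW' u (by simp [hu])]
  exact h.2

theorem HaltsAt.eq {E : TermEncoding U L V} {M : LDMachine} {W : Web U L}
    {x : List Symbol} {c c' : M.Config} (h : M.HaltsAt E W x c) (h' : M.HaltsAt E W x c') :
    c = c' := by
  have hunique : Relator.RightUnique (fun c₁ c₂ => M.step E W x c₁ = some c₂) :=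
    fun a b c hb hc => by simpa [hb] using hc
  have hstuck : ∀ {a b : M.Config}, M.step E W x a = none →
      Relation.ReflTransGen (fun c₁ c₂ => M.step E W x c₁ = some c₂) a b → a = b := by
    intro a b ha hab
    rcases hab.cases_head with h | ⟨d, hd, -⟩
    · exact h
    · simp [ha] at hd
  rcases Relation.ReflTransGen.total_of_right_unique hunique h.1 h'.1 with hc | hc
  · exact hstuck h.2 hc
  · exact (hstuck h'.2 hc).symm

/-! ### Finite query results are computable -/

/-- The machine that ignores its inputs and writes `w` on the output tape. -/
def writer (w : List Symbol) : LDMachine where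
  State := Fin (w.length + 1)
  finite_state := inferInstance
  Aux := Empty
  finite_aux := inferInstance
  start := 0
  -- Any state would do: the transitions ignore all tapes, so an expansion has no effect on the
  -- output.
  expand := Fin.last _
  accepting := ∅
  rejecting := ∅
  disjoint := disjoint_bot_left
  trans k _ _ _ :=
    if h : k.1 < w.length then
      some
        { next := ⟨k.1 + 1, by omega⟩
          moveInput := Move.stay
          writeWork := none
          moveWork := Move.stay
          writeLink := none
          moveLink := Move.stay
          output := some (Sum.inl w[k.1]) }
    else none

theorem writer_haltsAt (w x : List Symbol) :
    ∃ c, (writer w).HaltsAt E W x c ∧ c.output = w.map Sum.inl := by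
  -- The state counts the symbols already written.
  have hrun : ∀ k : ℕ, ∀ hk : k < w.length + 1, ∃ c : (writer w).Config,
      Relation.ReflTransGen (fun c₁ c₂ => (writer w).step E W x c₁ = some c₂)
        (writer w).init c ∧ c.state = (⟨k, hk⟩ : Fin (w.length + 1)) ∧
        c.output = (w.take k).map Sum.inl := by
    intro k
    induction k with
    | zero => exact fun _ => ⟨_, .refl, rfl, rfl⟩
    | succ k ih =>
      intro hk
      obtain ⟨c, hc, hs, ho⟩ := ih (by omega)
      have hk' : k < w.length := by omega
      have htrans : ∀ a b d, (writer w).trans c.state a b d = some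
          { next := (⟨k + 1, hk⟩ : Fin (w.length + 1))
            moveInput := Move.stay
            writeWork := none
            moveWork := Move.stay
            writeLink := none
            moveLink := Move.stay
            output := some (Sum.inl w[k]) } := by
        intro a b d
        rw [hs]
        exact dif_pos hk'
      refine ⟨_, hc.tail (by rw [step, htrans]; rfl), rfl, ?_⟩
      simp only [ho, Option.toList_some, List.take_succ_eq_append_getElem hk', List.map_append,
        List.map_cons, List.map_nil]
  obtain ⟨c, hc, hs, ho⟩ := hrun w.length (by omega)
  refine ⟨c, ⟨hc, ?_⟩, by simpa using ho⟩
  have htrans : ∀ a b d, (writer w).trans c.state a b d = none := by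
    intro a b d
    rw [hs]
    exact dif_neg (lt_irrefl _)
  rw [step, htrans]
  rfl

/-- The result of a query can be computed by an LD machine for the given Web if and only if it
is finite. -/
theorem exists_haltsComputing_iff [LinearOrder V] (Ω : Set (Valuation U L V)) :
    (∃ M : LDMachine, M.HaltsComputing E W Ω) ↔ Ω.Finite := by
  constructor
  · rintro ⟨M, c, -, w, ⟨l, -, hl, -⟩, -⟩
    exact l.finite_toSet.subset fun μ hμ => (hl μ).2 hμ
  · intro hΩ
    -- The encoding of the finite result is built into the machine.
    obtain ⟨c, hc, ho⟩ :=
      writer_haltsAt E W (hΩ.toFinset.toList.flatMap E.encValuation) []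
    exact ⟨_, c, hc, _, ⟨hΩ.toFinset.toList, Finset.nodup_toList _, by simp, rfl⟩, ho⟩

end LDMachine

/-! ### Webs that form a chain of documents -/

variable {U L V : Type*}

/-- The documents are the numbers; `i` is the document of the identifier with number `i`. -/
def indexedWeb (e : U ≃ ℕ) (data : ℕ → Finset (DataTriple U L)) : Web U L where
  Doc := ℕ
  countable_doc := inferInstance
  data := data
  adoc u := some (e u)
  adoc_surjective d := ⟨e.symm d, by simp⟩

/-- A link to the identifier with number `i + 1`. -/
def chainTriple (L : Type*) (e : U ≃ ℕ) (i : ℕ) : DataTriple U L :=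
  ⟨e.symm 0, e.symm 0, Sum.inl (e.symm (i + 1))⟩

open Classical in
/-- The chain in which the documents in `I` link to their successors and the other documents
are empty. -/
noncomputable def chainWeb (L : Type*) (e : U ≃ ℕ) (I : Set ℕ) : Web U L :=
  indexedWeb e fun i => if i ∈ I then {chainTriple L e i} else ∅

open Classical in
theorem mem_data_chainWeb {e : U ≃ ℕ} {I : Set ℕ} {i : ℕ} {t : DataTriple U L} :
    t ∈ (chainWeb L e I).data i ↔ i ∈ I ∧ t = chainTriple L e i := by
  change (t ∈ if i ∈ I then {chainTriple L e i} else (∅ : Finset (DataTriple U L))) ↔ _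
  split_ifs with h <;> simp [h]

/-- The criterion `c_All`, which always returns true. -/
def ReachabilityCriterion.cAll (E : TermEncoding U L V) : ReachabilityCriterion E where
  holds _ _ _ := true
  computable := ⟨fun _ => Part.some true, Computable.const true, fun _ _ _ _ _ => rfl⟩

/-- The query for all links that occur in the documents reachable from the first identifier. -/
def chainQuery (E : TermEncoding U L V) (e : U ≃ ℕ) (v : V) : CLDQuery E where
  pattern := {⟨Sum.inr (e.symm 0), Sum.inr (e.symm 0), Term.var v⟩}
  seeds := {e.symm 0}
  crit := ReachabilityCriterion.cAll E

theorem chainQuery_proper (E : TermEncoding U L V) (e : U ≃ ℕ) (v : V) :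
    (chainQuery E e v).seeds.Nonempty ∧
      (chainQuery E e v).crit.LessRestrictive (ReachabilityCriterion.cNone E) :=
  ⟨Finset.singleton_nonempty _, fun _ _ _ _ => rfl,
    chainTriple L e 0, e.symm 0, ∅, rfl, rfl⟩

theorem chainQuery_vars (E : TermEncoding U L V) (e : U ≃ ℕ) (v : V) :
    (chainQuery E e v).pattern.vars = {v} := by
  ext x
  simp [chainQuery, BQP.vars, TriplePattern.vars, TriplePattern.terms]

theorem chainQuery_reachable_univ (E : TermEncoding U L V) (e : U ≃ ℕ) (v : V) (i : ℕ) :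
    (chainWeb L e Set.univ).Reachable (chainQuery E e v).seeds (chainQuery E e v).crit
      (chainQuery E e v).pattern i := by
  induction i with
  | zero =>
    exact .seed (e.symm 0) _ (Finset.mem_singleton_self _) (congrArg some (e.apply_symm_apply 0))
  | succ i ih =>
    exact .link i (chainTriple L e i) (e.symm (i + 1)) _ ih
      (mem_data_chainWeb.2 ⟨trivial, rfl⟩) (Or.inr (Or.inr rfl)) rfl
      (congrArg some (e.apply_symm_apply (i + 1)))

/-- Links lead from `i` to `i + 1` or back to `0`, and document `n` has none, so nothing beyond `n`
is reached. -/
theorem chainQuery_reachable_le (E : TermEncoding U L V) (e : U ≃ ℕ) (v : V) {n i : ℕ}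
    (h : (chainWeb L e {n}ᶜ).Reachable (chainQuery E e v).seeds (chainQuery E e v).crit
      (chainQuery E e v).pattern i) : i ≤ n := by
  have key : ∀ d : (chainWeb L e {n}ᶜ).Doc, (chainWeb L e {n}ᶜ).Reachable
      (chainQuery E e v).seeds (chainQuery E e v).crit (chainQuery E e v).pattern d →
      LE.le (α := ℕ) d n := by
    intro d h
    induction h with
    | seed u d hu hd =>
      obtain rfl := Finset.mem_singleton.1 hu
      obtain rfl := Option.some.inj hd
      simp
    | link d' t u d _ ht hu _ hd ih =>
      obtain ⟨hn, rfl⟩ := mem_data_chainWeb.1 ht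
      obtain rfl := Option.some.inj hd
      have hlt : LT.lt (α := ℕ) d' n := lt_of_le_of_ne ih hn
      -- Subject and predicate point back to document `0`; only the object advances.
      rcases hu with rfl | rfl | hu
      · simp [chainTriple]
      · simp [chainTriple]
      · obtain rfl := Sum.inl.inj hu
        change e (e.symm (Nat.succ d')) ≤ n
        rw [e.apply_symm_apply]
        exact hlt
  exact key i h

/-! ### The answers to the chain query -/

/-- The valuation with domain `{v}` that maps `v` to `a`. -/
noncomputable def Valuation.single (v : V) (a : U ⊕ L) : Valuation U L V :=
  open Classical in
  { val := fun x => if x = v then some a else none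
    finite_dom := (Set.finite_singleton v).subset fun x hx => by
      by_contra h
      have h : x ≠ v := h
      simp [h] at hx }

theorem Valuation.coe_dom (μ : Valuation U L V) : (μ.dom : Set V) = {v | (μ.val v).isSome} :=
  Set.Finite.coe_toFinset _

theorem Valuation.coe_dom_eq_singleton {μ : Valuation U L V} {v : V} :
    (μ.dom : Set V) = {v} ↔ ∃ a, μ = single v a := by
  rw [coe_dom]
  constructor
  · intro h
    have hv : (μ.val v).isSome := (Set.ext_iff.1 h v).2 rfl
    obtain ⟨a, ha⟩ := Option.isSome_iff_exists.1 hv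
    refine ⟨a, ?_⟩
    obtain ⟨val, hf⟩ := μ
    simp only [single, Valuation.mk.injEq]
    funext x
    by_cases hx : x = v
    · subst hx
      simpa using ha
    · have := mt (Set.ext_iff.1 h x).1 hx
      simpa [hx] using this
  · rintro ⟨a, rfl⟩
    ext x
    by_cases hx : x = v <;> simp [single, hx]

theorem Valuation.single_injective (v : V) :
    Function.Injective (single v : U ⊕ L → Valuation U L V) := by
  intro a b h
  have := congrFun (congrArg Valuation.val h) v
  simpa [single] using this

/-- Each reachable document in `I` holds exactly one triple, which matches the pattern and binds `v`
to the identifier of the successor. -/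
theorem chainQuery_result (E : TermEncoding U L V) (e : U ≃ ℕ) (v : V) (I : Set ℕ) :
    (chainQuery E e v).result (chainWeb L e I) =
      (fun i : ℕ => Valuation.single v (Sum.inl (e.symm (i + 1)))) ''
        {i | i ∈ I ∧ (chainWeb L e I).Reachable (chainQuery E e v).seeds
          (chainQuery E e v).crit (chainQuery E e v).pattern i} := by
  ext μ
  simp only [CLDQuery.result, Set.mem_ofPred_eq, chainQuery_vars, Valuation.coe_dom_eq_singleton,
    Set.mem_image]
  have hsubst : ∀ a : U ⊕ L, (Valuation.single v a).substBQP (chainQuery E e v).pattern =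
      {(Term.id (e.symm 0), Term.id (e.symm 0), a.elim Term.id Term.lit)} := by
    intro a
    ext y
    simp [Valuation.substBQP, chainQuery, Valuation.substPattern, TriplePattern.terms,
      Valuation.substTerm, Valuation.single]
  constructor
  · rintro ⟨⟨a, rfl⟩, h⟩
    rw [hsubst, Set.singleton_subset_iff] at h
    obtain ⟨t, ⟨⟨d, hd⟩, ht⟩, htt⟩ := h
    obtain ⟨hI, rfl⟩ := mem_data_chainWeb.1 ht
    refine ⟨d, ⟨hI, hd⟩, ?_⟩
    -- Comparing objects determines an identifier `a` and excludes a literal.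
    rcases a with a | a <;> simp_all [chainTriple, DataTriple.terms]
  · rintro ⟨i, ⟨hI, hi⟩, rfl⟩
    refine ⟨⟨_, rfl⟩, ?_⟩
    rw [hsubst, Set.singleton_subset_iff]
    exact ⟨chainTriple L e i, ⟨⟨i, hi⟩, mem_data_chainWeb.2 ⟨hI, rfl⟩⟩, rfl⟩

theorem chainQuery_result_univ_infinite (E : TermEncoding U L V) (e : U ≃ ℕ) (v : V) :
    ((chainQuery E e v).result (chainWeb L e Set.univ)).Infinite := by
  rw [chainQuery_result]
  refine Set.Infinite.image ?_ (Set.infinite_univ.mono fun i _ =>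
    ⟨trivial, chainQuery_reachable_univ E e v i⟩)
  intro i _ j _ h
  have := Valuation.single_injective v h
  simpa using this

theorem chainQuery_result_compl_finite (E : TermEncoding U L V) (e : U ≃ ℕ) (v : V) (n : ℕ) :
    ((chainQuery E e v).result (chainWeb L e {n}ᶜ)).Finite := by
  rw [chainQuery_result]
  exact ((Set.finite_Iic n).subset fun i hi => chainQuery_reachable_le E e v hi.2).image _

theorem lookup_chainWeb_compl {e : U ≃ ℕ} {n : ℕ} {u : U} (h : e u ≠ n) :
    (chainWeb L e {n}ᶜ).lookup u = (chainWeb L e Set.univ).lookup u := by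
  simp [Web.lookup, chainWeb, indexedWeb, h]

end LinkedData

theorem mainTheorem3 {U L V : Type*}
    [Countable U] [Infinite U] [Countable L] [Infinite L] [Countable V] [Infinite V]
    [LinearOrder U] [LocallyFiniteOrderBot U] [LinearOrder L] [LinearOrder V]
    (E : LinkedData.TermEncoding U L V)
    (encQ : LinkedData.ProperCLDQuery E → List LinkedData.Symbol)
    (hencQ : Function.Injective encQ) :
    ¬ LinkedData.LDMachineDecidable E encQ Set.univ (LinkedData.ComputabilityCLD E) := by
  open LinkedData in
  rintro ⟨M, hM⟩
  obtain ⟨_⟩ := nonempty_denumerable U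
  -- Any enumeration will do; the chain need not follow the order of `U`.
  have e : U ≃ ℕ := Denumerable.eqv U
  obtain ⟨v⟩ : Nonempty V := inferInstance
  let q : ProperCLDQuery E := ⟨chainQuery E e v, chainQuery_proper E e v⟩
  have hno : ¬ ComputabilityCLD E (chainWeb L e Set.univ) q := fun h =>
    chainQuery_result_univ_infinite E e v ((LDMachine.exists_haltsComputing_iff E _ _).1 h)
  obtain ⟨c, hc, hrej⟩ := (hM _ trivial q).2 hno
  obtain ⟨F, hF⟩ := hc.exists_finset
  obtain ⟨u, hu⟩ := Infinite.exists_notMem_finset F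
  -- Cutting at `e u` changes the data of `u` alone, which the rejecting run did not consult. The
  -- query, and hence the input word, stays the same.
  have hc' := hF (chainWeb L e {e u}ᶜ) fun u' hu' =>
    lookup_chainWeb_compl fun h => hu (e.injective h ▸ hu')
  have hyes : ComputabilityCLD E (chainWeb L e {e u}ᶜ) q :=
    (LDMachine.exists_haltsComputing_iff E _ _).2 (chainQuery_result_compl_finite E e v (e u))
  obtain ⟨c', hc'', hacc⟩ := (hM _ trivial q).1 hyes
  obtain rfl := hc'.eq hc''
  exact Set.disjoint_left.1 M.disjoint hacc hrej
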